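/- Let $\mathfrak g$ be a finite-dimensional semisimple Lie algebra over an algebraically closed field of characteristic zero. For $M\subset\mathfrak g$ write $\mathfrak z_{\mathfrak g}(M)$ for the centralizer of $M$ in $\mathfrak g$. An $\mathfrak{sl}_2$-triple is a triple $\{e,\tilde h,f\}$ with $[\tilde h,e]=2e$, $[\tilde h,f]=-2f$, $[e,f]=\tilde h$ (the zero triple is allowed). Let $(e_1,e_2)$ be a semi-principal rectangular pair, that is, a pair of nilpotent elements of $\mathfrak g$ for which there are $\mathfrak{sl}_2$-triples $\{e_1,\tilde h_1,f_1\}$ and $\{e_2,\tilde h_2,f_2\}$, commuting with each other, such that - $e_1$ is distinguished in $\mathfrak l_2:=\mathfrak z_{\mathfrak g}(\tilde h_2)$, i.e. every semisimple element of $\mathfrak z_{\mathfrak l_2}(e_1)$ lies in the centre $\mathfrak c_2$ of $\mathfrak l_2$; - $e_2$ is even in $\mathfrak k_1:=\mathfrak z_{\mathfrak g}(e_1,\tilde h_1)$, i.e. all eigenvalues of $\operatorname{ad}\tilde h_2$ on $\mathfrak k_1$ are even integers. Fix such triples and put $\mathfrak k_2:=\mathfrak z_{\mathfrak g}(e_2,\tilde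 h_2)$. Then: (i) $\mathfrak z_{\mathfrak g}(e_1,\tilde h_1,\tilde h_2)=\mathfrak c_2$; (ii) $\mathfrak c_2$ is a Cartan subalgebra of $\mathfrak k_1$, and $e_2$ is a regular nilpotent element of $\mathfrak k_1$, i.e. it is nilpotent and $\dim\mathfrak z_{\mathfrak k_1}(e_2)=\operatorname{rk}\mathfrak k_1$; (iii) $(\mathfrak k_1,\mathfrak k_2)$ is a reductive dual pair in $\mathfrak g$, i.e. $\mathfrak k_2=\mathfrak z_{\mathfrak g}(\mathfrak k_1)$, $\mathfrak k_1=\mathfrak z_{\mathfrak g}(\mathfrak k_2)$, and both $\mathfrak k_1$ and $\mathfrak k_2$ are reductive in $\mathfrak g$ (the radical of $\mathfrak k_i$ equals its centre, and that centre consists of semisimple elements of $\mathfrak g$). -/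

import Mathlib

namespace SemiPrincipal

section Basic

variable (K : Type*) {g : Type*} [Field K] [LieRing g] [LieAlgebra K g]

/-- The centralizer `z_g(M)` of a subset `M` of a Lie algebra `g`. -/
def centralizer (M : Set g) : LieSubalgebra K g where
  carrier := {x | ∀ m ∈ M, ⁅x, m⁆ = 0}
  zero_mem' := fun m _ => zero_lie m
  add_mem' := fun {x y} hx hy m hm => by rw [add_lie, hx m hm, hy m hm, add_zero]
  smul_mem' := fun c x hx m hm => by rw [smul_lie, hx m hm, smul_zero]
  lie_mem' := fun {x y} hx hy m hm => by
    rw [lie_lie, hx m hm, hy m hm, lie_zero, lie_zero, sub_zero]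

variable {K}

/-- The centre of a subalgebra `l`, as a subalgebra of the ambient Lie algebra. -/
def centre (l : LieSubalgebra K g) : LieSubalgebra K g := l ⊓ centralizer K (l : Set g)

variable (K)

/-- `x` is a semisimple element of the (semisimple) Lie algebra `g`. -/
def IsSemisimpleElement (x : g) : Prop := (LieAlgebra.ad K g x).IsSemisimple

/-- `x` is a nilpotent element of the (semisimple) Lie algebra `g`. -/
def IsNilpotentElement (x : g) : Prop := IsNilpotent (LieAlgebra.ad K g x)

/-- The defining relations of an `sl₂`-triple `{e, h, f}`. The zero triple is allowed; for `e ≠ 0`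
(in characteristic zero) this says that `e, h, f` span a copy of `sl₂`. -/
structure IsTriple {g : Type*} [LieRing g] (e h f : g) : Prop where
  lie_h_e : ⁅h, e⁆ = 2 • e
  lie_h_f : ⁅h, f⁆ = -(2 • f)
  lie_e_f : ⁅e, f⁆ = h

variable {K}

/-- `e` is a distinguished nilpotent element of the subalgebra `l` (to be used for `l` a
centralizer of a semisimple element): every semisimple element of `z_l(e)` is central in `l`. -/
def IsDistinguishedIn (l : LieSubalgebra K g) (e : g) : Prop :=
  e ∈ l ∧ IsNilpotentElement K e ∧
    ∀ x ∈ l, ⁅x, e⁆ = 0 → IsSemisimpleElement K x → x ∈ centre l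

/-- The nilpotent element of the subalgebra `a` belonging to the `sl₂`-triple `{e, h, f}` of `a` is
even in `a`: all eigenvalues of `ad h` on `a` are even integers. -/
def IsEvenIn (a : LieSubalgebra K g) (e h f : g) : Prop :=
  (e ∈ a ∧ h ∈ a ∧ f ∈ a) ∧ IsTriple e h f ∧
    ∀ c : K, (∃ x ∈ a, x ≠ 0 ∧ ⁅h, x⁆ = c • x) → ∃ n : ℤ, c = 2 * (n : K)

/-- `e` is a regular nilpotent element of the subalgebra `a`: it is nilpotent, lies in `a`, and
`dim z_a(e)` is the rank of `a`. -/
def IsRegularNilpotentIn [FiniteDimensional K g] (a : LieSubalgebra K g) (e : g) : Prop :=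
  e ∈ a ∧ IsNilpotentElement K e ∧
    Module.finrank K ↥(a ⊓ centralizer K {e}) = LieAlgebra.rank K ↥a

/-- The subalgebra `c` of `g` is contained in `a` and is a Cartan subalgebra of `a`. -/
def IsCartanSubalgebraOf (a c : LieSubalgebra K g) : Prop :=
  c ≤ a ∧ (c.comap a.incl).IsCartanSubalgebra

/-- `a` is a reductive subalgebra of `g`: the Lie algebra `a` is reductive (its radical is its
centre), and moreover its centre consists of semisimple elements of `g`. -/
def IsReductiveSubalgebra (a : LieSubalgebra K g) : Prop :=
  LieAlgebra.HasCentralRadical K ↥a ∧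
    ∀ x ∈ centre a, IsSemisimpleElement K x

/-- `(a, b)` is a dual pair: each is the centralizer of the other. -/
def IsDualPair (a b : LieSubalgebra K g) : Prop :=
  b = centralizer K (a : Set g) ∧ a = centralizer K (b : Set g)

/-- A dual pair both of whose members are reductive. -/
def IsReductiveDualPair (a b : LieSubalgebra K g) : Prop :=
  IsDualPair a b ∧ IsReductiveSubalgebra a ∧ IsReductiveSubalgebra b

variable (K)

/-- `(e₁, e₂)` is a semi-principal rectangular pair, with `{e₁, h₁, f₁}` and `{e₂, h₂, f₂}` the
commuting `sl₂`-triples that witness this. -/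
structure IsSemiPrincipalRectangular (e₁ h₁ f₁ e₂ h₂ f₂ : g) : Prop where
  nilpotent₁ : IsNilpotentElement K e₁
  nilpotent₂ : IsNilpotentElement K e₂
  triple₁ : IsTriple e₁ h₁ f₁
  triple₂ : IsTriple e₂ h₂ f₂
  commute : ∀ x ∈ ({e₁, h₁, f₁} : Set g), ∀ y ∈ ({e₂, h₂, f₂} : Set g), ⁅x, y⁆ = 0
  distinguished : IsDistinguishedIn (centralizer K {h₂}) e₁
  even : IsEvenIn (centralizer K {e₁, h₁}) e₂ h₂ f₂

end Basic

end SemiPrincipal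

/-! Write `q` for the centralizer of `e₁, h₁, h₂`, the zero weight space of `h₂` in `k₁`. The
Killing form of `g` stays nondegenerate on `k₁` and `k₂` (centralizers of `sl₂`-triples) and on `q`,
since `k₁` is the sum of `q` and `⁅h₂, k₁⁆`, which is orthogonal to `q`.

For (i), distinguishedness puts every semisimple element of `q` in `c₂`, so it is central in `q`. By
Jordan decomposition and Engel, `q` is nilpotent, hence abelian by nondegeneracy. Nilpotent parts
are then orthogonal to `q`, so they vanish, and `q` is `c₂`.

For (ii), `c₂` is abelian and is the kernel of the diagonalizable `ad h₂` on `k₁`, hence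
self-normalizing. Evenness gives `ad e₂` and `ad h₂` kernels of equal dimension on `k₁`
(`finrank_ker_E`). This dimension is the rank: one bound comes from Engel subalgebras, the other
from `finrank_ker_ad_le_rank`.

For (iii), an element of `k₂` commutes with `e₂, f₂` and, lying in `l₂`, with `c₂`. By evenness the
zero weight space generates `k₁` under `e₂, f₂` (`eq_top_of_ker_le`), so `k₂` commutes with `k₁`.
Reductivity follows from nondegeneracy of the trace form. -/

open Module Module.End

/-! ### Linear algebra of kernels, eigenspaces and commutators. -/

section LinearAlgebra

variable {K V : Type*} [Field K] [AddCommGroup V] [Module K V]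

/-- An endomorphism that preserves and is injective on a finite-dimensional subspace maps that
subspace onto itself. -/
lemma exists_mem_apply_eq_of_injOn [FiniteDimensional K V] (T : End K V) (Z : Submodule K V)
    (hT : ∀ v ∈ Z, T v ∈ Z) (hinj : ∀ v ∈ Z, T v = 0 → v = 0) {v : V} (hv : v ∈ Z) :
    ∃ u ∈ Z, T u = v := by
  have hi : Function.Injective (T.restrict hT) := by
    rw [← LinearMap.ker_eq_bot, LinearMap.ker_eq_bot']
    intro m hm
    exact Subtype.ext (hinj m m.2 (congrArg Subtype.val hm))
  obtain ⟨u, hu⟩ := (LinearMap.injective_iff_surjective.mp hi) ⟨v, hv⟩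
  exact ⟨u, u.2, congrArg Subtype.val hu⟩

/-- A diagonalizable endomorphism splits the space into its kernel and its range. -/
lemma ker_sup_range_eq_top {H : End K V} (hH : ⨆ μ, H.eigenspace μ = ⊤) :
    LinearMap.ker H ⊔ LinearMap.range H = ⊤ := by
  rw [eq_top_iff, ← hH]
  refine iSup_le fun μ v hv ↦ ?_
  rw [mem_eigenspace_iff] at hv
  by_cases hμ : μ = 0
  · exact Submodule.mem_sup_left (by simpa [hμ] using hv)
  · exact Submodule.mem_sup_right ⟨μ⁻¹ • v, by simp [hv, hμ]⟩

/-- In characteristic zero, an eigenvector of a commutator with nonzero eigenvalue is nilpotent. -/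
lemma isNilpotent_of_commutator_eq_smul [CharZero K] [FiniteDimensional K V] {H E : End K V}
    {μ : K} (hμ : μ ≠ 0) (h : ∀ v, H (E v) = E (H v) + μ • E v) : IsNilpotent E := by
  have hpow (k : ℕ) : ∀ v, H ((E ^ k) v) = (E ^ k) (H v) + (k * μ) • (E ^ k) v := by
    induction k with
    | zero => simp
    | succ k ih =>
      intro v
      rw [pow_succ, End.mul_apply, End.mul_apply, ih, h]
      simp only [map_add, map_smul]
      push_cast
      module
  by_contra hE
  have hne (k : ℕ) : E ^ k ≠ 0 := fun hk ↦ hE ⟨k, hk⟩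
  -- Nonzero powers `E ^ k` would be eigenvectors of `[H, ·]` for the infinitely many eigenvalues `k
  -- * μ`.
  let T : End K (End K V) := LinearMap.mulLeft K H - LinearMap.mulRight K H
  have hT (k : ℕ) : T.HasEigenvalue (k * μ) := by
    refine hasEigenvalue_of_hasEigenvector (x := E ^ k) ⟨?_, hne k⟩
    rw [mem_eigenspace_iff]
    ext v
    simp [T, hpow k v]
  refine Set.infinite_univ (α := ℕ) (Set.Finite.of_finite_image (f := fun k : ℕ ↦ (k : K) * μ)
    (T.finite_hasEigenvalue.subset ?_) ?_)
  · rintro _ ⟨k, -, rfl⟩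
    exact hT k
  · intro a _ b _ hab
    exact Nat.cast_injective (mul_right_cancel₀ hμ hab)

end LinearAlgebra

/-! ### Finite-dimensional representations of `sl₂`, without complete reducibility. -/

/-- Three endomorphisms satisfying the commutation relations of `sl₂`. -/
structure IsSl2Action {K V : Type*} [Field K] [AddCommGroup V] [Module K V]
    (E H F : End K V) : Prop where
  hE : ∀ v, H (E v) = E (H v) + (2 : K) • E v
  hF : ∀ v, H (F v) = F (H v) - (2 : K) • F v
  eF : ∀ v, E (F v) = F (E v) + H v

namespace IsSl2Action

variable {K V : Type*} [Field K] [AddCommGroup V] [Module K V] {E H F : End K V}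

lemma symm (t : IsSl2Action E H F) : IsSl2Action F (-H) E where
  hE v := by simp [t.hF]; module
  hF v := by simp [t.hE]; module
  eF v := by simp [t.eF]

lemma mem_maxGenEigenspace_neg {T : End K V} {μ : K} {v : V} :
    v ∈ (-T).maxGenEigenspace μ ↔ v ∈ T.maxGenEigenspace (-μ) := by
  rw [mem_maxGenEigenspace, mem_maxGenEigenspace]
  refine exists_congr fun k ↦ ?_
  have : -T - μ • (1 : End K V) = -(T - (-μ) • (1 : End K V)) := by module
  rw [this, neg_pow]
  rcases neg_one_pow_eq_or (End K V) k with h | h <;> simp [h]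

lemma mem_eigenspace_neg {T : End K V} {μ : K} {v : V} :
    v ∈ (-T).eigenspace μ ↔ v ∈ T.eigenspace (-μ) := by
  simp [neg_eq_iff_eq_neg]

/-- Where `E ^ (k + 1)` kills both `v` and `F v`, this gives `E ^ k` killing `(H + k) v`; the
inductions on nilpotency order below rest on it. -/
lemma f_e_pow (t : IsSl2Action E H F) (k : ℕ) : ∀ v,
    F ((E ^ (k + 1)) v) = (E ^ (k + 1)) (F v) - ((k : K) + 1) • (E ^ k) (H v + (k : K) • v) := by
  induction k with
  | zero => intro v; simp [t.eF]
  | succ k ih =>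
    intro v
    have h1 : (E ^ (k + 1 + 1)) v = (E ^ (k + 1)) (E v) := by rw [pow_succ, End.mul_apply]
    have h2 : F (E v) = E (F v) - H v := by simp [t.eF]
    have h3 (w : V) : (E ^ k) (E w) = (E ^ (k + 1)) w := by rw [pow_succ, End.mul_apply]
    have h4 : (E ^ (k + 1 + 1)) (F v) = (E ^ (k + 1)) (E (F v)) := by
      rw [pow_succ, End.mul_apply]
    rw [h1, ih, h2, t.hE, h4]
    simp only [map_add, map_sub, map_smul, h3]
    push_cast
    module

lemma mapsTo_E (t : IsSl2Action E H F) {μ : K} {v : V} (hv : v ∈ H.maxGenEigenspace μ) :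
    E v ∈ H.maxGenEigenspace (μ + 2) := by
  rw [mem_maxGenEigenspace] at hv ⊢
  obtain ⟨k, hk⟩ := hv
  refine ⟨k, ?_⟩
  have (k : ℕ) : ∀ v, ((H - (μ + 2) • (1 : End K V)) ^ k) (E v) =
      E (((H - μ • (1 : End K V)) ^ k) v) := by
    induction k with
    | zero => simp
    | succ k ih =>
      intro v
      rw [pow_succ, pow_succ, End.mul_apply, End.mul_apply, ← ih]
      congr 1
      simp [t.hE]
      module
  rw [this, hk, map_zero]

lemma mapsTo_F (t : IsSl2Action E H F) {μ : K} {v : V} (hv : v ∈ H.maxGenEigenspace μ) :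
    F v ∈ H.maxGenEigenspace (μ - 2) := by
  have := t.symm.mapsTo_E (μ := -μ) (v := v) (by rwa [mem_maxGenEigenspace_neg, neg_neg])
  rw [mem_maxGenEigenspace_neg] at this
  convert this using 2
  ring

lemma mapsTo_E_eigenspace (t : IsSl2Action E H F) {μ : K} {v : V} (hv : v ∈ H.eigenspace μ) :
    E v ∈ H.eigenspace (μ + 2) := by
  rw [mem_eigenspace_iff] at hv ⊢
  rw [t.hE, hv, map_smul]; module

lemma mapsTo_F_eigenspace (t : IsSl2Action E H F) {μ : K} {v : V} (hv : v ∈ H.eigenspace μ) :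
    F v ∈ H.eigenspace (μ - 2) := by
  rw [mem_eigenspace_iff] at hv ⊢
  rw [t.hF, hv, map_smul]; module

lemma H_mem_maxGenEigenspace {μ : K} {v : V} (hv : v ∈ H.maxGenEigenspace μ) :
    H v ∈ H.maxGenEigenspace μ :=
  mapsTo_maxGenEigenspace_of_comm (Commute.refl H) μ hv

lemma eq_zero_of_mem_maxGenEigenspace {μ ν : K} (h : μ ≠ ν) {v : V}
    (hv : v ∈ H.maxGenEigenspace μ) (hv' : H v = ν • v) : v = 0 := by
  have h1 : v ∈ H.maxGenEigenspace ν := by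
    rw [mem_maxGenEigenspace]
    exact ⟨1, by simp [hv']⟩
  exact Submodule.disjoint_def.mp (H.disjoint_genEigenspace h ⊤ ⊤) v hv h1

variable [CharZero K] [FiniteDimensional K V]

lemma isNilpotent_E (t : IsSl2Action E H F) : IsNilpotent E :=
  isNilpotent_of_commutator_eq_smul two_ne_zero t.hE

lemma isNilpotent_F (t : IsSl2Action E H F) : IsNilpotent F :=
  t.symm.isNilpotent_E

/-- An `H`-stable subspace annihilated by `E F` on which `H` has none of the eigenvalues
`0, -1, -2, …` is zero. -/
lemma eq_zero_of_E_F (t : IsSl2Action E H F) (Z : Submodule K V) (hZ : ∀ v ∈ Z, H v ∈ Z)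
    (hEF : ∀ v ∈ Z, E (F v) = 0) (hinj : ∀ k : ℕ, ∀ v ∈ Z, H v = -(k : K) • v → v = 0) :
    ∀ v ∈ Z, v = 0 := by
  obtain ⟨n, hn⟩ := t.isNilpotent_E
  suffices ∀ m, (∀ v ∈ Z, (E ^ m) v = 0) → ∀ v ∈ Z, v = 0 from this n (by simp [hn])
  intro m
  induction m with
  | zero => simp
  | succ k ih =>
    refine fun hk ↦ ih fun v hv ↦ ?_
    -- `H + k` is invertible on `Z`, so `v = (H + k) u`, and `f_e_pow` at `u` lowers the exponent
    -- killing `Z`.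
    obtain ⟨u, hu, rfl⟩ := exists_mem_apply_eq_of_injOn (H + (k : K) • (1 : End K V)) Z
      (fun v hv ↦ by simpa using add_mem (hZ v hv) (Z.smul_mem _ hv))
      (fun v hv h0 ↦ hinj k v hv (by
        rw [neg_smul]; exact eq_neg_of_add_eq_zero_left (by simpa using h0))) hv
    have h1 := t.f_e_pow k u
    rw [hk u hu, map_zero, pow_succ, End.mul_apply, hEF u hu, map_zero, zero_sub, eq_comm,
      neg_eq_zero, smul_eq_zero] at h1
    simpa using h1.resolve_left (Nat.cast_add_one_ne_zero k)

end IsSl2Action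

namespace IsSl2Action

variable {K V : Type*} [Field K] [AddCommGroup V] [Module K V] {E H F : End K V}
variable [CharZero K] [FiniteDimensional K V]

lemma eq_zero_of_E_F_of_mem_maxGenEigenspace (t : IsSl2Action E H F) {μ : K}
    (hμ : ∀ k : ℕ, μ ≠ -(k : K)) {v : V} (hv : v ∈ H.maxGenEigenspace μ) (h : E (F v) = 0) :
    v = 0 := by
  have hcomm (w : V) : E (F (H w)) = H (E (F w)) := by
    rw [t.hE, t.hF]; simp
  refine t.eq_zero_of_E_F (H.maxGenEigenspace μ ⊓ LinearMap.ker (E * F)) ?_ ?_ ?_ v ⟨hv, h⟩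
  · rintro w ⟨hw, hw'⟩
    refine ⟨H_mem_maxGenEigenspace hw, ?_⟩
    change E (F w) = 0 at hw'
    change E (F (H w)) = 0
    rw [hcomm, hw', map_zero]
  · rintro w ⟨-, hw'⟩
    exact hw'
  · rintro k w ⟨hw, -⟩ hk
    exact eq_zero_of_mem_maxGenEigenspace (hμ k) hw hk

/-- The operator `E F` is onto on generalized eigenspaces for eigenvalues other than
`0, -1, -2, …`. -/
lemma exists_E_F_eq_of_mem_maxGenEigenspace (t : IsSl2Action E H F) {μ : K}
    (hμ : ∀ k : ℕ, μ ≠ -(k : K)) {v : V} (hv : v ∈ H.maxGenEigenspace μ) :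
    ∃ u ∈ H.maxGenEigenspace μ, E (F u) = v :=
  exists_mem_apply_eq_of_injOn (E * F) _
    (fun w hw ↦ by simpa using t.mapsTo_E (t.mapsTo_F hw))
    (fun w hw h ↦ t.eq_zero_of_E_F_of_mem_maxGenEigenspace hμ hw h) hv

/-- On vectors killed by `E`, generalized eigenvectors of `H` are eigenvectors. -/
lemma apply_eq_smul_of_E_eq_zero (t : IsSl2Action E H F) {μ : K} {v : V}
    (hv : v ∈ H.maxGenEigenspace μ) (hE : E v = 0) : H v = μ • v := by
  set Z : Submodule K V := H.maxGenEigenspace μ ⊓ LinearMap.ker E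
  have hHZ : ∀ w ∈ Z, H w ∈ Z := by
    rintro w ⟨hw, hw'⟩
    refine ⟨H_mem_maxGenEigenspace hw, ?_⟩
    have h1 := t.hE w
    change E w = 0 at hw'
    change E (H w) = 0
    rw [hw'] at h1
    simpa using h1.symm
  have hshift (ν : K) : ∀ w ∈ Z, H w - ν • w ∈ Z := fun w hw ↦
    sub_mem (hHZ w hw) (Z.smul_mem _ hw)
  have hdesc (k : ℕ) : ∀ w ∈ Z, (F ^ (k + 1)) w = 0 → (F ^ k) (H w - (k : K) • w) = 0 := by
    rintro w ⟨-, hw⟩ h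
    change E w = 0 at hw
    have h1 := t.symm.f_e_pow k w
    rw [h, hw, map_zero, map_zero, zero_sub, eq_comm, neg_eq_zero, smul_eq_zero] at h1
    have h2 := h1.resolve_left (Nat.cast_add_one_ne_zero k)
    rw [← neg_eq_zero, ← map_neg]
    rw [← h2]
    congr 1
    simp
    abel
  have hsurj (k : ℕ) (hk : μ ≠ k) : ∀ w ∈ Z, ∃ u ∈ Z, H u - (k : K) • u = w := fun w hw ↦
    exists_mem_apply_eq_of_injOn (H - (k : K) • (1 : End K V)) Z
      (fun w hw ↦ by simpa using hshift k w hw)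
      (fun w hw h0 ↦ eq_zero_of_mem_maxGenEigenspace hk hw.1
        (sub_eq_zero.mp (by simpa using h0))) hw
  -- On `ker E`, nilpotency of `F` makes the product of `H - k` over `k < n` vanish. Each root is
  -- simple, so `H - μ` occurs at most once and the other factors are invertible on `Z`. The second
  -- clause records that the factor `k = μ` is still unused.
  have key (n : ℕ) : (∀ w ∈ Z, (F ^ n) (H w - μ • w) = 0) ∧
      ((∃ m < n, μ = (m : ℕ)) → ∀ w ∈ Z, (F ^ n) w = 0) → ∀ w ∈ Z, H w - μ • w = 0 := by
    induction n with
    | zero => rintro ⟨h, -⟩; simpa using h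
    | succ k ih =>
      rintro ⟨h1, h2⟩
      refine ih ⟨?_, ?_⟩
      · by_cases hk : μ = k
        · intro w hw
          have := hdesc k w hw (h2 ⟨k, k.lt_succ_self, hk⟩ w hw)
          rwa [← hk] at this
        · intro w hw
          obtain ⟨u, hu, rfl⟩ := hsurj k hk w hw
          have := hdesc k _ (hshift μ u hu) (h1 u hu)
          rw [← this]
          congr 1
          simp only [map_sub, map_smul]
          module
      · rintro ⟨m, hm, rfl⟩ w hw
        obtain ⟨u, hu, rfl⟩ := hsurj k (by exact_mod_cast hm.ne) w hw
        exact hdesc k u hu (h2 ⟨m, hm.trans k.lt_succ_self, rfl⟩ u hu)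
  obtain ⟨n, hn⟩ := t.isNilpotent_F
  exact sub_eq_zero.mp (key n ⟨by simp [hn], by simp [hn]⟩ v ⟨hv, hE⟩)

/-- Descent from `μ + 2 * n`, where the generalized eigenspace is zero. Since `E F` is onto in
weight `ν + 2`, each `w` of weight `ν` differs from some `F u` by a vector killed by `E`, and both
pieces are eigenvectors. -/
lemma apply_eq_smul_of_ne (t : IsSl2Action E H F) {μ : K} (hμ : ∀ k : ℕ, μ ≠ -(k : K) - 2) {v : V}
    (hv : v ∈ H.maxGenEigenspace μ) : H v = μ • v := by
  have step (ν : K) (hν : ∀ k : ℕ, ν ≠ -(k : K) - 2)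
      (ih : ∀ w ∈ H.maxGenEigenspace (ν + 2), H w = (ν + 2) • w) :
      ∀ w ∈ H.maxGenEigenspace ν, H w = ν • w := by
    intro w hw
    obtain ⟨u, hu, huw⟩ := t.exists_E_F_eq_of_mem_maxGenEigenspace
      (fun k hk ↦ hν k (eq_sub_of_add_eq hk)) (t.mapsTo_E hw)
    have hFu : F u ∈ H.maxGenEigenspace ν := by
      simpa using t.mapsTo_F hu
    have h1 := t.apply_eq_smul_of_E_eq_zero (sub_mem hw hFu) (by rw [map_sub, huw, sub_self])
    have h2 : H (F u) = ν • F u := by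
      rw [t.hF, ih u hu, map_smul]; module
    rw [map_sub, h2, smul_sub] at h1
    simpa using h1
  obtain ⟨n, hn⟩ : ∃ n : ℕ, H.maxGenEigenspace (μ + 2 * n) = ⊥ := by
    by_contra! hne
    refine Set.infinite_univ (α := ℕ)
      (Set.Finite.of_finite_image (f := fun k : ℕ ↦ μ + 2 * (k : K))
      (H.finite_hasEigenvalue.subset ?_) ?_)
    · rintro _ ⟨k, -, rfl⟩
      have hk : H.HasUnifEigenvalue (μ + 2 * (k : K)) ⊤ := hne k
      exact hk.lt one_pos
    · intro a _ b _ hab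
      simpa using hab
  suffices ∀ m ≤ n, ∀ w ∈ H.maxGenEigenspace (μ + 2 * ((n - m : ℕ) : K)),
      H w = (μ + 2 * ((n - m : ℕ) : K)) • w by
    simpa using this n le_rfl v (by simpa using hv)
  intro m
  induction m with
  | zero =>
    intro _ w hw
    rw [Nat.sub_zero, hn, Submodule.mem_bot] at hw
    simp [hw]
  | succ m ih =>
    intro hm
    have hcast : ((n - m : ℕ) : K) = ((n - (m + 1) : ℕ) : K) + 1 := by
      rw [show n - m = n - (m + 1) + 1 by omega]; simp
    refine step _ (fun k hk ↦ hμ (k + 2 * (n - (m + 1))) ?_) ?_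
    · push_cast
      linear_combination hk
    · have := ih (by omega)
      rwa [hcast, mul_add, mul_one, ← add_assoc] at this

/-- In a finite-dimensional representation of `sl₂`, generalized eigenvectors of `H` are
eigenvectors. -/
lemma maxGenEigenspace_eq (t : IsSl2Action E H F) (μ : K) :
    H.maxGenEigenspace μ = H.eigenspace μ := by
  refine le_antisymm (fun v hv ↦ mem_eigenspace_iff.mpr ?_) (H.genEigenspace μ |>.mono le_top)
  -- The weights excluded above become `k + 2` for the opposite triple, which are allowed there.
  by_cases hμ : ∃ k : ℕ, μ = -(k : K) - 2
  · obtain ⟨k, rfl⟩ := hμ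
    have := t.symm.apply_eq_smul_of_ne (μ := k + 2) (v := v) (fun m hm ↦ ?_) ?_
    · rw [LinearMap.neg_apply, neg_eq_iff_eq_neg] at this
      rw [this]; module
    · have : ((k + m + 4 : ℕ) : K) = 0 := by push_cast; linear_combination hm
      exact absurd (Nat.cast_eq_zero.mp this) (by omega)
    · rw [mem_maxGenEigenspace_neg]
      convert hv using 2
      ring
  · push Not at hμ
    exact t.apply_eq_smul_of_ne hμ hv

lemma eq_zero_of_E_F_of_mem_eigenspace (t : IsSl2Action E H F) {μ : K}
    (hμ : ∀ k : ℕ, μ ≠ -(k : K)) {v : V} (hv : v ∈ H.eigenspace μ) (h : E (F v) = 0) : v = 0 :=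
  t.eq_zero_of_E_F_of_mem_maxGenEigenspace hμ ((t.maxGenEigenspace_eq μ).ge hv) h

lemma exists_E_F_eq (t : IsSl2Action E H F) {μ : K} (hμ : ∀ k : ℕ, μ ≠ -(k : K)) {v : V}
    (hv : v ∈ H.eigenspace μ) : ∃ u ∈ H.eigenspace μ, E (F u) = v := by
  simpa only [t.maxGenEigenspace_eq] using
    t.exists_E_F_eq_of_mem_maxGenEigenspace hμ ((t.maxGenEigenspace_eq μ).ge hv)

/-- A vector killed by `E` and `H` is killed by `F`. -/
lemma F_eq_zero (t : IsSl2Action E H F) {v : V} (hE : E v = 0) (hH : H v = 0) : F v = 0 := by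
  refine t.symm.eq_zero_of_E_F_of_mem_eigenspace (μ := 2) (fun k hk ↦ ?_) ?_ ?_
  · have : ((k + 2 : ℕ) : K) = 0 := by push_cast; linear_combination hk
    exact absurd (Nat.cast_eq_zero.mp this) (by omega)
  · rw [mem_eigenspace_neg, mem_eigenspace_iff, t.hF, hH]; simp
  · rw [t.eF, hE, hH]; simp

/-- The zero eigenspace of `H` is spanned by invariants and the image of `F`. -/
lemma exists_invariant_add_F (t : IsSl2Action E H F) {v : V} (hH : H v = 0) :
    ∃ w u, E w = 0 ∧ H w = 0 ∧ v = w + F u := by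
  have hEv : E v ∈ H.eigenspace 2 := by
    rw [mem_eigenspace_iff, t.hE, hH]; simp
  -- `E F` is onto in weight 2, so `F u` corrects `v` to a vector killed by `E`.
  obtain ⟨u, hu, huv⟩ := t.exists_E_F_eq (fun k hk ↦ by
    have : ((k + 2 : ℕ) : K) = 0 := by push_cast; linear_combination hk
    exact absurd (Nat.cast_eq_zero.mp this) (by omega)) hEv
  refine ⟨v - F u, u, by rw [map_sub, huv, sub_self], ?_, by abel⟩
  rw [map_sub, hH, t.hF, mem_eigenspace_iff.mp hu, map_smul, sub_self, sub_zero]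

/-- In a finite-dimensional representation of `sl₂`, the operator `H` is diagonalizable. -/
lemma iSup_eigenspace_eq_top [IsAlgClosed K] (t : IsSl2Action E H F) : ⨆ μ, H.eigenspace μ = ⊤ := by
  simpa only [t.maxGenEigenspace_eq] using iSup_maxGenEigenspace_eq_top H

end IsSl2Action

/-! ### Jordan decomposition and Killing orthogonality. -/

section Jordan

variable {K g : Type*} [Field K] [IsAlgClosed K] [LieRing g] [LieAlgebra K g]
  [FiniteDimensional K g]

/-- Abstract Jordan decomposition: every element of a Lie algebra with nondegenerate Killing form
is the sum of an ad-semisimple element, which commutes with everything the given element commutes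
with, and an ad-nilpotent element. -/
lemma exists_isSemisimple_ad_isNilpotent_ad_sub [LieAlgebra.IsKilling K g] (x : g) :
    ∃ s : g, (LieAlgebra.ad K g s).IsSemisimple ∧ IsNilpotent (LieAlgebra.ad K g (x - s)) ∧
      ∀ y : g, ⁅x, y⁆ = 0 → ⁅s, y⁆ = 0 := by
  obtain ⟨N, -, S, hS₀, hN, hS, hSN⟩ := (LieAlgebra.ad K g x).exists_isNilpotent_isSemisimple
  replace hS₀ : Commute (LieAlgebra.ad K g x) S := Algebra.commute_of_mem_adjoin_self hS₀
  rw [eq_sub_of_add_eq hSN.symm] at hN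
  have aux {μ : K} {y : g} (hy : y ∈ (LieAlgebra.ad K g x).maxGenEigenspace μ) : S y = μ • y :=
    apply_eq_of_mem_of_comm_of_isFinitelySemisimple_of_isNil hy hS₀ hS.isFinitelySemisimple hN
  -- `S` is the scalar `μ` on the generalized `μ`-eigenspace of `ad x`, and brackets add these
  -- eigenvalues; so `S` is a derivation, hence inner.
  have h_der (y z : g) : S ⁅y, z⁆ = ⁅S y, z⁆ + ⁅y, S z⁆ := by
    have hy : y ∈ ⨆ μ, (LieAlgebra.ad K g x).maxGenEigenspace μ := by
      simp [iSup_maxGenEigenspace_eq_top]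
    have hz : z ∈ ⨆ μ, (LieAlgebra.ad K g x).maxGenEigenspace μ := by
      simp [iSup_maxGenEigenspace_eq_top]
    induction hy using Submodule.iSup_induction' with
    | mem μ y hy =>
      induction hz using Submodule.iSup_induction' with
      | mem ν z hz =>
        rw [aux hy, aux hz, aux (LieModule.lie_mem_maxGenEigenspace_toEnd hy hz), smul_lie,
          lie_smul, ← add_smul]
      | zero => simp
      | add _ _ _ _ h h' => simp only [lie_add, map_add, h, h']; abel
    | zero => simp
    | add _ _ _ _ h h' => simp only [add_lie, map_add, h, h']; abel
  obtain ⟨s, hs⟩ := LieDerivation.IsKilling.exists_eq_ad (R := K) (L := g) ⟨S, fun y z ↦ by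
    rw [h_der, ← lie_skew (S y) z]; abel⟩
  have hsS : LieAlgebra.ad K g s = S := by
    rw [← LieDerivation.coe_ad_apply_eq_ad_apply, hs]
  refine ⟨s, hsS ▸ hS, by rwa [map_sub, hsS], fun y hy ↦ ?_⟩
  rw [← LieAlgebra.ad_apply (R := K), hsS, aux (μ := 0), zero_smul]
  rw [mem_maxGenEigenspace]
  exact ⟨1, by simp [hy]⟩

end Jordan

/-- Commuting with an ad-nilpotent element implies Killing-orthogonality to it. -/
lemma killingForm_eq_zero_of_isNilpotent_ad {K g : Type*} [Field K] [LieRing g] [LieAlgebra K g]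
    {x y : g}
    (hx : IsNilpotent (LieAlgebra.ad K g x)) (hxy : ⁅x, y⁆ = 0) : killingForm K g x y = 0 := by
  have hc : Commute (LieAlgebra.ad K g x) (LieAlgebra.ad K g y) := by
    ext z
    simp [leibniz_lie x y z, hxy]
  exact (LinearMap.isNilpotent_trace_of_isNilpotent (hc.isNilpotent_mul_right hx)).eq_zero

/-! ### Nondegenerate trace forms and the radical. -/

section CentralRadical

open LieModule LieAlgebra

variable {K L : Type*} [Field K] [IsAlgClosed K] [CharZero K] [LieRing L] [LieAlgebra K L]

/-- If `a` belongs to a solvable ideal, then `⁅y, a⁆ w` acts nilpotently for all `y` and `w`. -/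
lemma isNilpotent_toEnd_lie_mul_toEnd (A : LieIdeal K L) [IsSolvable A] (y w : L) {a : L}
    (ha : a ∈ A) (M : Type*) [AddCommGroup M] [Module K M] [LieRingModule L M] [LieModule K L M]
    [FiniteDimensional K M] : IsNilpotent (toEnd K L M ⁅y, a⁆ * toEnd K L M w) := by
  induction hn : finrank K M using Nat.strong_induction_on generalizing M with
  | _ n ih =>
  rcases subsingleton_or_nontrivial M with hM | hM
  · exact ⟨1, Subsingleton.elim _ _⟩
  obtain ⟨χ, hχ⟩ := exists_nontrivial_weightSpace_of_isSolvable K A M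
  -- As in Lie's theorem, this weight space is stable under all of `L`. There `⁅y, a⁆` is a scalar
  -- of trace zero, hence zero.
  let W : LieSubmodule K L M := weightSpaceOfIsLieTower K M (χ : A → K)
  have hW (b : L) (hb : b ∈ A) (m : M) (hm : m ∈ W) : ⁅b, m⁆ = χ ⟨b, hb⟩ • m :=
    (mem_weightSpace (χ : A → K) m).mp hm ⟨b, hb⟩
  have hWpos : 0 < finrank K W := by
    have : Nontrivial W := hχ
    exact finrank_pos
  have hz : ⁅y, a⁆ ∈ A := lie_mem_right K L A y a ha
  have hχz : χ ⟨⁅y, a⁆, hz⟩ = 0 := by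
    have h1 : toEnd K L W ⁅y, a⁆ = χ ⟨⁅y, a⁆, hz⟩ • (1 : End K W) := by
      ext m
      exact hW _ hz m m.2
    have h2 : LinearMap.trace K W (toEnd K L W ⁅y, a⁆) = 0 := by
      refine trace_toEnd_eq_zero_of_mem_lcs K L W le_rfl ?_
      exact LieSubmodule.lie_mem_lie (LieSubmodule.mem_top y) (LieSubmodule.mem_top a)
    rw [h1, map_smul, LinearMap.trace_one, smul_eq_mul] at h2
    exact (mul_eq_zero.mp h2).resolve_right (by exact_mod_cast hWpos.ne')
  have hlt : finrank K (M ⧸ W) < n := by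
    have := Submodule.finrank_quotient_add_finrank W.toSubmodule
    change finrank K (M ⧸ W) + finrank K W = _ at this
    omega
  obtain ⟨m, hm⟩ := ih _ hlt (M ⧸ W) rfl
  -- The `m`-th power maps `M` into `W`; one more factor kills `W`, since `w` preserves it and `⁅y,
  -- a⁆` annihilates it.
  refine ⟨m + 1, ?_⟩
  ext v
  rw [pow_succ', End.mul_apply, LinearMap.zero_apply]
  let π : M → M ⧸ W := LieSubmodule.Quotient.mk' W
  have hmk (k : ℕ) (v : M) : π (((toEnd K L M ⁅y, a⁆ * toEnd K L M w) ^ k) v) =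
      ((toEnd K L (M ⧸ W) ⁅y, a⁆ * toEnd K L (M ⧸ W) w) ^ k) (π v) := by
    induction k with
    | zero => rfl
    | succ k ih =>
      rw [pow_succ', pow_succ', End.mul_apply, End.mul_apply (_ * _), ← ih]
      rfl
  have hmem := hmk m v
  rw [hm, LinearMap.zero_apply] at hmem
  rw [End.mul_apply, toEnd_apply_apply, toEnd_apply_apply,
    hW _ hz _ (W.lie_mem ((LieSubmodule.Quotient.mk_eq_zero W).mp hmem)), hχz, zero_smul]

/-- A Lie algebra with a representation whose trace form is nondegenerate has central radical. -/
lemma hasCentralRadical_of_ker_traceForm_eq_bot [FiniteDimensional K L] (M : Type*)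
    [AddCommGroup M] [Module K M] [LieRingModule L M] [LieModule K L M] [FiniteDimensional K M]
    (h : LinearMap.ker (traceForm K L M) = ⊥) : HasCentralRadical K L := by
  refine hasCentralRadical_of_radical_le K L fun a ha ↦ ?_
  rw [mem_maxTrivSubmodule]
  intro y
  rw [← LieSubmodule.mem_bot (R := K) (L := L), ← LieSubmodule.mem_toSubmodule,
    LieSubmodule.bot_toSubmodule, ← h, LinearMap.mem_ker]
  ext w
  exact (LinearMap.isNilpotent_trace_of_isNilpotent
    (isNilpotent_toEnd_lie_mul_toEnd (radical K L) y w ha M)).eq_zero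

end CentralRadical

/-! ### Leading forms of polynomials along curves. -/

section LeadingForm

variable {K ι : Type*} [Field K]

lemma MvPolynomial.IsHomogeneous.aeval_X_mul {φ : MvPolynomial ι K} {n : ℕ}
    (hφ : φ.IsHomogeneous n) (u : ι → Polynomial K) :
    MvPolynomial.aeval (fun i ↦ Polynomial.X * u i) φ = Polynomial.X ^ n * MvPolynomial.aeval u φ := by
  rw [MvPolynomial.aeval_def, MvPolynomial.eval₂_eq, MvPolynomial.aeval_def,
    MvPolynomial.eval₂_eq, Finset.mul_sum]
  refine Finset.sum_congr rfl fun m hm ↦ ?_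
  have hdeg : ∑ i ∈ m.support, m i = n := by
    rw [← hφ (MvPolynomial.mem_support_iff.mp hm)]
    simp [Finsupp.weight_apply, Finsupp.sum]
  simp_rw [mul_pow, Finset.prod_mul_distrib, Finset.prod_pow_eq_pow_sum, hdeg]
  ring

/-- The leading form at a point `a` of a nonzero polynomial `p` governs the lowest order behaviour
of `p` along all polynomial curves through `a`. -/
lemma MvPolynomial.exists_leadingForm {p : MvPolynomial ι K} (hp : p ≠ 0) (a : ι → K) :
    ∃ (q : MvPolynomial ι K) (d : ℕ), q ≠ 0 ∧ ∀ γ : ι → Polynomial K,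
      (∀ i, (γ i).coeff 0 = a i) →
        (aeval γ p).coeff d = eval (fun i ↦ (γ i).coeff 1) q := by
  classical
  -- With `a` moved to the origin, `q` is the lowest nonzero homogeneous component, and a curve
  -- through the origin is `X` times a curve.
  set p' : MvPolynomial ι K := aeval (fun i ↦ X i + C (a i)) p with hp'
  have hback : aeval (fun i ↦ X i - C (a i)) p' = p := by
    rw [hp', comp_aeval_apply]
    simp
  have hp'0 : p' ≠ 0 := fun h ↦ hp (by rw [← hback, h, map_zero])
  have hex : ∃ d, homogeneousComponent d p' ≠ 0 := by
    by_contra! h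
    exact hp'0 (by rw [← sum_homogeneousComponent p']; simp [h])
  refine ⟨homogeneousComponent (Nat.find hex) p', Nat.find hex, Nat.find_spec hex,
    fun γ hγ ↦ ?_⟩
  set d := Nat.find hex
  have hγX (i : ι) : γ i - Polynomial.C (a i) = Polynomial.X * (γ i).divX := by
    rw [sub_eq_iff_eq_add, ← hγ, Polynomial.X_mul_divX_add]
  have h1 : aeval γ p = aeval (fun i ↦ Polynomial.X * (γ i).divX) p' := by
    rw [hp', comp_aeval_apply]
    congr 2
    ext1 i
    simp [← hγX]
  have hterm (i : ℕ) : (aeval (fun i ↦ Polynomial.X * (γ i).divX)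
      (homogeneousComponent i p')).coeff d =
      if i = d then eval (fun i ↦ (γ i).coeff 1) (homogeneousComponent d p') else 0 := by
    rw [(homogeneousComponent_isHomogeneous i p').aeval_X_mul, Polynomial.coeff_X_pow_mul']
    rcases lt_trichotomy i d with h | h | h
    · have : homogeneousComponent i p' = 0 := not_not.mp (Nat.find_min hex h)
      simp [this, h.ne]
    · subst h
      simp only [le_refl, if_true, Nat.sub_self]
      rw [Polynomial.coeff_zero_eq_aeval_zero, comp_aeval_apply]
      simp only [← Polynomial.coeff_zero_eq_aeval_zero, Polynomial.coeff_divX]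
      simp [aeval_eq_eval]
    · rw [if_neg h.not_ge, if_neg h.ne']
  conv_lhs => rw [h1, ← sum_homogeneousComponent p', map_sum, Polynomial.finsetSum_coeff]
  simp only [hterm, Finset.sum_ite_eq', Finset.mem_range]
  split_ifs with h
  · rfl
  · exact absurd (homogeneousComponent_eq_zero _ _ (by omega)) (Nat.find_spec hex)

end LeadingForm

/-! ### Centralizers of diagonalizable elements and the rank. -/

section Rank

variable {K L : Type*} [Field K] [CharZero K] [LieRing L] [LieAlgebra K L] [FiniteDimensional K L]

open LieAlgebra

open scoped Nat in
/-- The characteristic polynomial of the adjoint action is invariant under exponentials of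
nilpotent inner derivations. -/
lemma charpoly_ad_sum_inv_factorial_smul {y : L} {N : ℕ} (hN : ad K L y ^ N = 0) (x : L) :
    (ad K L (∑ k ∈ Finset.range N, ((k ! : K)⁻¹) • (ad K L y ^ k) x)).charpoly =
      (ad K L x).charpoly := by
  let _ : Module ℚ L := Module.compHom L (algebraMap ℚ K)
  let _ : LieAlgebra ℚ L := { lie_smul := fun t x y ↦ lie_smul (algebraMap ℚ K t) x y }
  have hD : ((LieDerivation.ad K L y : LieDerivation K L L) : L →ₗ[K] L) = ad K L y :=
    LieDerivation.coe_ad_apply_eq_ad_apply y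
  have hnil : IsNilpotent ((LieDerivation.ad K L y : LieDerivation K L L) : L →ₗ[K] L) :=
    ⟨N, by rw [hD, hN]⟩
  have hexp : LieDerivation.exp (LieDerivation.ad K L y) hnil x =
      ∑ k ∈ Finset.range N, ((k ! : K)⁻¹) • (ad K L y ^ k) x := by
    rw [LieDerivation.exp_map_apply, hD, IsNilpotent.exp_eq_sum hN, LinearMap.sum_apply]
    refine Finset.sum_congr rfl fun k _ ↦ ?_
    change (algebraMap ℚ K (k ! : ℚ)⁻¹) • (ad K L y ^ k) x = _
    simp
  rw [← hexp, ← LieAlgebra.conj_ad_apply, LinearEquiv.charpoly_conj]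

open scoped Nat in
/-- If `h` is ad-diagonalizable with abelian centralizer, then the dimension of this centralizer
is at most the rank of the Lie algebra. -/
lemma finrank_ker_ad_le_rank {h : L} (hdiag : ⨆ μ, (ad K L h).eigenspace μ = ⊤)
    (hab : ∀ x y : L, ⁅h, x⁆ = 0 → ⁅h, y⁆ = 0 → ⁅x, y⁆ = 0) :
    finrank K (LinearMap.ker (ad K L h)) ≤ rank K L := by
  by_contra! hlt
  let b := Module.finBasis K L
  set r := rank K L with hr
  -- `P` is a nonzero polynomial function, by definition of the rank. Its leading form `Q` at `h`
  -- will vanish on `ker (ad h)` and be invariant under translation by the other eigenspaces, hence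
  -- be zero.
  let P : L → K := fun x ↦ (ad K L x).charpoly.coeff r
  obtain ⟨p, hp, hpP⟩ : ∃ p : MvPolynomial (Fin (finrank K L)) K,
      p ≠ 0 ∧ ∀ x, MvPolynomial.eval (b.repr x) p = P x :=
    ⟨_, LieAlgebra.polyCharpoly_coeff_rank_ne_zero K L b,
      fun x ↦ LinearMap.polyCharpoly_coeff_eval _ b x r⟩
  obtain ⟨q, d, hq, hγ⟩ := MvPolynomial.exists_leadingForm hp (fun i ↦ b.repr h i)
  let Q : L → K := fun v ↦ MvPolynomial.eval (b.repr v) q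
  have hcurve (c : ℕ → L) (N : ℕ) (hc : c 0 = h) : ∃ F : Polynomial K,
      (∀ t, F.eval t = P (∑ k ∈ Finset.range (N + 2), t ^ k • c k)) ∧ F.coeff d = Q (c 1) := by
    let γ : Fin (finrank K L) → Polynomial K := fun i ↦
      ∑ k ∈ Finset.range (N + 2), Polynomial.C (b.repr (c k) i) * Polynomial.X ^ k
    have hcoeff (i) (j : ℕ) (hj : j < N + 2) : (γ i).coeff j = b.repr (c j) i := by
      simp [γ, Polynomial.coeff_X_pow, hj]
    refine ⟨MvPolynomial.aeval γ p, fun t ↦ ?_, ?_⟩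
    · rw [← hpP, ← Polynomial.coe_aeval_eq_eval, MvPolynomial.comp_aeval_apply,
        MvPolynomial.aeval_eq_eval]
      have : (fun i ↦ Polynomial.aeval t (γ i)) =
          b.repr (∑ k ∈ Finset.range (N + 2), t ^ k • c k) := by
        ext i
        rw [map_sum, map_sum, Finsupp.finsetSum_apply]
        refine Finset.sum_congr rfl fun k _ ↦ ?_
        rw [map_mul, map_pow, Polynomial.aeval_X, Polynomial.aeval_C, map_smul, Finsupp.smul_apply,
          smul_eq_mul, mul_comm]
        rfl
      rw [this]
    · rw [hγ γ fun i ↦ by rw [hcoeff i 0 (by omega), hc]]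
      simp only [hcoeff _ 1 (show 1 < N + 2 by omega)]
      rfl
  have hline (v : L) : ∃ F : Polynomial K,
      (∀ t, F.eval t = P (h + t • v)) ∧ F.coeff d = Q v := by
    obtain ⟨F, hF, hFd⟩ := hcurve (fun k ↦ if k = 0 then h else v) 0 rfl
    exact ⟨F, fun t ↦ by simp [hF, Finset.sum_range_succ], by simpa using hFd⟩
  -- All of `ker (ad h)` commutes with `h + t • v`, so zero has multiplicity above `r` and `P`
  -- vanishes on the line.
  have hker (v : L) (hv : ⁅h, v⁆ = 0) : Q v = 0 := by
    obtain ⟨F, hF, hFd⟩ := hline v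
    suffices F = 0 by rw [← hFd, this, Polynomial.coeff_zero]
    refine Polynomial.funext fun t ↦ ?_
    rw [hF, Polynomial.eval_zero]
    apply Polynomial.coeff_eq_zero_of_lt_natTrailingDegree
    rw [← LinearMap.finrank_maxGenEigenspace_zero_eq]
    refine hlt.trans_le (Submodule.finrank_mono fun x hx ↦ ?_)
    rw [mem_maxGenEigenspace]
    refine ⟨1, ?_⟩
    rw [LinearMap.mem_ker, ad_apply] at hx
    simp [hx, hab v x hv hx]
  have hshift (v : L) {μ : K} (hμ : μ ≠ 0) {m : L} (hm : m ∈ (ad K L h).eigenspace μ) :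
      Q (v + m) = Q v := by
    rw [mem_eigenspace_iff, ad_apply] at hm
    set y : L := -(μ⁻¹ • m) with hy
    have hyh : ⁅y, h⁆ = m := by
      rw [hy, neg_lie, lie_skew, lie_smul, hm, smul_smul, inv_mul_cancel₀ hμ, one_smul]
    have hhy : ⁅h, y⁆ = μ • y := by
      rw [hy, lie_neg, lie_smul, hm, smul_neg, smul_comm]
    obtain ⟨N, hN⟩ : IsNilpotent (ad K L y) :=
      isNilpotent_of_commutator_eq_smul (H := ad K L h) hμ fun v ↦ by
        simp only [ad_apply]
        rw [leibniz_lie, hhy, smul_lie, add_comm]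
    -- These are the coefficients in `t` of `exp (t ad y) (h + t v)`. The linear one is `v + ⁅y, h⁆
    -- = v + m`, and `P` agrees with its values on the line `h + t v`.
    let c : ℕ → L := fun k ↦ Nat.casesOn k h fun k ↦
      (((k + 1)! : ℕ) : K)⁻¹ • (ad K L y ^ (k + 1)) h + ((k ! : ℕ) : K)⁻¹ • (ad K L y ^ k) v
    have hN2 : ad K L y ^ (N + 1) = 0 := by rw [pow_succ, hN, zero_mul]
    obtain ⟨F, hF, hFd⟩ := hcurve c N rfl
    obtain ⟨G, hG, hGd⟩ := hline v
    have hc1 : c 1 = v + m := by simp [c, hyh, add_comm]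
    rw [← hc1, ← hFd, ← hGd]
    congr 1
    refine Polynomial.funext fun t ↦ ?_
    rw [hF, hG]
    have hsum : ∑ k ∈ Finset.range (N + 2), t ^ k • c k =
        ∑ k ∈ Finset.range (N + 1), ((k ! : K)⁻¹) • (ad K L (t • y) ^ k) (h + t • v) := by
      have h1 : ∑ k ∈ Finset.range (N + 1), ((k ! : K)⁻¹) • (ad K L (t • y) ^ k) h =
          ∑ k ∈ Finset.range (N + 2), ((k ! : K)⁻¹) • (ad K L (t • y) ^ k) h := by
        rw [Finset.sum_range_succ _ (N + 1)]
        simp [smul_pow, hN2]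
      simp only [map_add, smul_add, Finset.sum_add_distrib]
      rw [h1, Finset.sum_range_succ', Finset.sum_range_succ' (fun k ↦ _ • (_ : L)) (N + 1)]
      simp only [c, smul_add, Finset.sum_add_distrib, map_smul, smul_pow, LinearMap.smul_apply]
      rw [add_right_comm]
      congr 2
      · congr 1
        ext k
        rw [smul_comm]
      · simp
      · ext k
        rw [pow_succ]; module
    change Polynomial.coeff _ _ = Polynomial.coeff _ _
    rw [hsum, charpoly_ad_sum_inv_factorial_smul]
    simp [smul_pow, hN2]
  have hreduce : ∀ x ∈ ⨆ μ, (ad K L h).eigenspace μ,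
      ∃ v, ⁅h, v⁆ = 0 ∧ ∀ u, Q (u + x) = Q (u + v) := by
    intro x hx
    induction hx using Submodule.iSup_induction' with
    | mem μ x hx =>
      by_cases hμ : μ = 0
      · exact ⟨x, by simpa [hμ] using hx, fun _ ↦ rfl⟩
      · exact ⟨0, lie_zero h, fun u ↦ by rw [hshift u hμ hx, add_zero]⟩
    | zero => exact ⟨0, lie_zero h, fun _ ↦ rfl⟩
    | add x y _ _ hx hy =>
      obtain ⟨v, hv, hv'⟩ := hx
      obtain ⟨w, hw, hw'⟩ := hy
      exact ⟨v + w, by rw [lie_add, hv, hw, add_zero], fun u ↦ by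
        rw [← add_assoc, hw', add_right_comm, hv', add_right_comm, add_assoc]⟩
  refine hq (MvPolynomial.funext fun w ↦ ?_)
  obtain ⟨v, hv, hv'⟩ := hreduce (b.equivFun.symm w) (by rw [hdiag]; exact Submodule.mem_top)
  have h0 : Q (b.equivFun.symm w) = 0 := by
    have := hv' 0
    rwa [zero_add, zero_add, hker v hv] at this
  rw [map_zero, ← h0]
  congr 2
  exact (b.equivFun.apply_symm_apply w).symm

end Rank

/-! ### Representations of `sl₂` with even weights. -/

namespace IsSl2Action

variable {K V : Type*} [Field K] [AddCommGroup V] [Module K V] {E H F : End K V}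
variable [CharZero K] [FiniteDimensional K V]

lemma exists_mem_eigenspace_E_eq (t : IsSl2Action E H F) (n : ℕ) {v : V}
    (hv : v ∈ H.eigenspace (2 * (n : K) + 2)) : ∃ u ∈ H.eigenspace (2 * (n : K)), E u = v := by
  obtain ⟨u, hu, huv⟩ := t.exists_E_F_eq (fun k hk ↦ by
    have : ((2 * n + 2 + k : ℕ) : K) = 0 := by push_cast; linear_combination hk
    exact absurd (Nat.cast_eq_zero.mp this) (by omega)) hv
  exact ⟨F u, by simpa using t.mapsTo_F_eigenspace hu, huv⟩

/-- A subspace stable under `E` and containing the zero eigenspace of `H` contains the eigenspaces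
for all nonnegative even integers. -/
lemma eigenspace_le_of_ker_le (t : IsSl2Action E H F) {C : Submodule K V}
    (hC : ∀ v ∈ C, E v ∈ C) (h0 : LinearMap.ker H ≤ C) (n : ℕ) :
    H.eigenspace (2 * (n : K)) ≤ C := by
  induction n with
  | zero => simpa using h0
  | succ n ih =>
    intro v hv
    obtain ⟨u, hu, rfl⟩ := t.exists_mem_eigenspace_E_eq n
      (by simpa [mul_add] using hv)
    exact hC u (ih hu)

variable [IsAlgClosed K]

/-- If all eigenvalues of `H` are even, then the zero eigenspace of `H` generates the
representation. -/
lemma eq_top_of_ker_le (t : IsSl2Action E H F)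
    (heven : ∀ c : K, (∃ v, v ≠ 0 ∧ H v = c • v) → ∃ n : ℤ, c = 2 * (n : K))
    {C : Submodule K V} (hE : ∀ v ∈ C, E v ∈ C) (hF : ∀ v ∈ C, F v ∈ C)
    (h0 : LinearMap.ker H ≤ C) : C = ⊤ := by
  rw [eq_top_iff, ← t.iSup_eigenspace_eq_top]
  refine iSup_le fun μ v hv ↦ ?_
  by_cases hv0 : v = 0
  · rw [hv0]; exact C.zero_mem
  obtain ⟨n, rfl⟩ := heven μ ⟨v, hv0, mem_eigenspace_iff.mp hv⟩
  obtain ⟨n, rfl | rfl⟩ := n.eq_nat_or_neg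
  · exact t.eigenspace_le_of_ker_le hE h0 n (by simpa using hv)
  · refine t.symm.eigenspace_le_of_ker_le hF (fun w hw ↦ h0 (by simpa using hw)) n ?_
    rw [mem_eigenspace_neg]
    simpa using hv

/-- If all eigenvalues of `H` are even, then the kernels of `E` and `H` have the same dimension. -/
lemma finrank_ker_E (t : IsSl2Action E H F)
    (heven : ∀ c : K, (∃ v, v ≠ 0 ∧ H v = c • v) → ∃ n : ℤ, c = 2 * (n : K)) :
    finrank K (LinearMap.ker E) = finrank K (LinearMap.ker H) := by
  -- `W` collects the nonnegative weights and `W'` the positive ones. `E` maps `W` onto `W'` with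
  -- kernel all of `ker E`, and `W` is `ker H ⊕ W'`; compare dimensions.
  set W : Submodule K V := ⨆ n : ℕ, H.eigenspace (2 * (n : K)) with hW
  set W' : Submodule K V := ⨆ n : ℕ, H.eigenspace (2 * (n : K) + 2)
  have hker : LinearMap.ker E ≤ W := by
    have hstable : ∀ v ∈ LinearMap.ker E, H v ∈ LinearMap.ker E := by
      intro v hv
      rw [LinearMap.mem_ker] at hv ⊢
      have := t.hE v
      rw [hv] at this
      simpa using this.symm
    have hdecomp := Submodule.inf_iSup_genEigenspace hstable 1
    rw [show (⨆ μ, H.genEigenspace μ 1) = ⊤ from t.iSup_eigenspace_eq_top, inf_top_eq] at hdecomp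
    rw [hdecomp]
    refine iSup_le fun μ v hv ↦ ?_
    obtain ⟨hv, hvμ⟩ := hv
    change E v = 0 at hv
    change v ∈ H.eigenspace μ at hvμ
    by_cases hv0 : v = 0
    · rw [hv0]; exact W.zero_mem
    obtain ⟨n, rfl⟩ := heven μ ⟨v, hv0, mem_eigenspace_iff.mp hvμ⟩
    obtain ⟨n, rfl | rfl⟩ := n.eq_nat_or_neg
    · exact Submodule.mem_iSup_of_mem n (by simpa using hvμ)
    · rcases Nat.eq_zero_or_pos n with rfl | hn
      · exact Submodule.mem_iSup_of_mem 0 (by simpa using hvμ)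
      · refine absurd (t.symm.eq_zero_of_E_F_of_mem_eigenspace (μ := 2 * (n : K)) (fun k hk ↦ ?_) ?_
          (by rw [hv, map_zero])) hv0
        · have : ((2 * n + k : ℕ) : K) = 0 := by push_cast; linear_combination hk
          exact absurd (Nat.cast_eq_zero.mp this) (by omega)
        · rw [mem_eigenspace_neg]
          simpa using hvμ
  have hmap : W.map E = W' := by
    refine le_antisymm ?_ (iSup_le fun n v hv ↦ ?_)
    · rw [hW, Submodule.map_iSup]
      refine iSup_le fun n ↦ ?_
      rintro _ ⟨v, hv, rfl⟩
      exact Submodule.mem_iSup_of_mem n (t.mapsTo_E_eigenspace hv)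
    · obtain ⟨u, hu, rfl⟩ := t.exists_mem_eigenspace_E_eq n hv
      exact ⟨u, Submodule.mem_iSup_of_mem n hu, rfl⟩
  have hsup : LinearMap.ker H ⊔ W' = W := by
    refine le_antisymm (sup_le ?_ ?_) (iSup_le fun n ↦ ?_)
    · rw [← eigenspace_zero]
      simpa using le_iSup (fun n : ℕ ↦ H.eigenspace (2 * (n : K))) 0
    · refine iSup_le fun n ↦ ?_
      have := le_iSup (fun n : ℕ ↦ H.eigenspace (2 * (n : K))) (n + 1)
      simpa [mul_add] using this
    · cases n with
      | zero => simp
      | succ n =>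
        refine le_sup_of_le_right ?_
        have := le_iSup (fun n : ℕ ↦ H.eigenspace (2 * (n : K) + 2)) n
        simpa [mul_add] using this
  have hdisj : Disjoint (LinearMap.ker H) W' := by
    rw [← eigenspace_zero]
    refine (H.eigenspaces_iSupIndep 0).mono_right (iSup_le fun n ↦ ?_)
    refine le_iSup₂_of_le (2 * (n : K) + 2) (fun h ↦ ?_) le_rfl
    have : ((2 * n + 2 : ℕ) : K) = 0 := by push_cast; exact h
    exact absurd (Nat.cast_eq_zero.mp this) (by omega)
  have h1 := Submodule.finrank_sup_add_finrank_inf_eq (LinearMap.ker H) W'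
  rw [hdisj.eq_bot, finrank_bot, hsup] at h1
  have h2 := LinearMap.finrank_range_add_finrank_ker (E.domRestrict W)
  rw [LinearMap.range_domRestrict, hmap, LinearMap.ker_domRestrict,
    (Submodule.comapSubtypeEquivOfLe hker).finrank_eq] at h2
  omega

end IsSl2Action

/-! ### Centralizers with nondegenerate Killing form. -/

namespace SemiPrincipal

variable {K g : Type*} [Field K] [LieRing g] [LieAlgebra K g]

lemma IsTriple.isSl2Action {e h f : g} (t : IsTriple e h f) :
    IsSl2Action (LieAlgebra.ad K g e) (LieAlgebra.ad K g h) (LieAlgebra.ad K g f) where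
  hE v := by
    simp only [LieAlgebra.ad_apply]
    rw [leibniz_lie, t.lie_h_e, two_smul, two_smul, add_lie, add_comm]
  hF v := by
    simp only [LieAlgebra.ad_apply]
    rw [leibniz_lie, t.lie_h_f, two_smul, two_smul, neg_lie, add_lie, neg_add_eq_sub]
  eF v := by
    simp only [LieAlgebra.ad_apply]
    rw [leibniz_lie, t.lie_e_f, add_comm]

variable [CharZero K] [FiniteDimensional K g]

/-- The centralizer of `e` and `h` also centralizes `f`. -/
lemma IsTriple.lie_f_eq_zero (K : Type*) [Field K] [LieAlgebra K g] [CharZero K]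
    [FiniteDimensional K g] {e h f x : g} (t : IsTriple e h f)
    (he : ⁅x, e⁆ = 0) (hh : ⁅x, h⁆ = 0) : ⁅x, f⁆ = 0 := by
  rw [← lie_skew, neg_eq_zero] at he hh ⊢
  exact (t.isSl2Action (K := K)).F_eq_zero he hh

variable [IsAlgClosed K]

/-- The Killing form is nondegenerate on the centralizer of an `sl₂`-triple. -/
lemma IsTriple.eq_zero_of_killingForm_eq_zero [LieAlgebra.IsKilling K g] {e h f : g}
    (t : IsTriple e h f) {x : g} (hx : x ∈ centralizer K {e, h})
    (hxk : ∀ y ∈ centralizer K {e, h}, killingForm K g x y = 0) : x = 0 := by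
  have hxe : ⁅x, e⁆ = 0 := hx e (by simp)
  have hxh : ⁅x, h⁆ = 0 := hx h (by simp)
  have hxf := t.lie_f_eq_zero K hxe hxh
  -- By invariance `x` is orthogonal to the images of `ad f` and `ad h`, which together with the
  -- centralizer span `g`.
  have hbracket (y u : g) (hy : ⁅x, y⁆ = 0) : killingForm K g x ⁅y, u⁆ = 0 := by
    rw [← LieModule.traceForm_apply_lie_apply, hy, map_zero, LinearMap.zero_apply]
  have t' := t.isSl2Action (K := K)
  suffices ∀ y, killingForm K g x y = 0 from
    (LieAlgebra.IsKilling.killingForm_nondegenerate K g).1 x this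
  intro y
  have hy : y ∈ LinearMap.ker (LieAlgebra.ad K g h) ⊔ LinearMap.range (LieAlgebra.ad K g h) := by
    rw [ker_sup_range_eq_top t'.iSup_eigenspace_eq_top]; exact Submodule.mem_top
  obtain ⟨v, hv, _, ⟨w, rfl⟩, rfl⟩ := Submodule.mem_sup.mp hy
  obtain ⟨z, u, hez, hhz, rfl⟩ := t'.exists_invariant_add_F hv
  have hz : z ∈ centralizer K {e, h} := by
    rintro m (rfl | rfl)
    · rw [← lie_skew, neg_eq_zero]; exact hez
    · rw [← lie_skew, neg_eq_zero]; exact hhz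
  rw [map_add, map_add, hxk z hz, LieAlgebra.ad_apply, LieAlgebra.ad_apply, hbracket f u hxf,
    hbracket h w hxh, add_zero, add_zero]

/-- A centralizer on which the Killing form is nondegenerate is reductive. -/
lemma isReductiveSubalgebra_centralizer [LieAlgebra.IsKilling K g] {M : Set g}
    (hM : ∀ x ∈ centralizer K M, (∀ y ∈ centralizer K M, killingForm K g x y = 0) → x = 0) :
    IsReductiveSubalgebra (centralizer K M) := by
  refine ⟨hasCentralRadical_of_ker_traceForm_eq_bot g ?_, fun x hx ↦ ?_⟩
  · rw [LinearMap.ker_eq_bot']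
    rintro ⟨x, hx⟩ h
    refine Subtype.ext (hM x hx fun y hy ↦ ?_)
    exact congrArg (fun φ ↦ φ ⟨y, hy⟩) h
  · obtain ⟨s, hs, hn, hcomm⟩ := exists_isSemisimple_ad_isNilpotent_ad_sub (K := K) x
    -- For central `x` the nilpotent part commutes with the whole centralizer, so it is orthogonal
    -- to it.
    have hxs : x - s = 0 := by
      refine hM _ (sub_mem hx.1 fun m hm ↦ hcomm m (hx.1 m hm)) fun y hy ↦ ?_
      refine killingForm_eq_zero_of_isNilpotent_ad hn ?_
      rw [sub_lie, hx.2 y hy, hcomm y (hx.2 y hy), sub_zero]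
    rw [sub_eq_zero.mp hxs]
    exact hs

end SemiPrincipal

namespace SemiPrincipal

variable {K g : Type*} [Field K] [LieRing g] [LieAlgebra K g]

lemma mem_centralizer_pair {e h x : g} :
    x ∈ centralizer K {e, h} ↔ ⁅x, e⁆ = 0 ∧ ⁅x, h⁆ = 0 :=
  ⟨fun hx ↦ ⟨hx e (by simp), hx h (by simp)⟩, by rintro ⟨h1, h2⟩ m (rfl | rfl) <;> assumption⟩

lemma mem_centralizer_triple {e h k x : g} :
    x ∈ centralizer K {e, h, k} ↔ ⁅x, e⁆ = 0 ∧ ⁅x, h⁆ = 0 ∧ ⁅x, k⁆ = 0 :=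
  ⟨fun hx ↦ ⟨hx e (by simp), hx h (by simp), hx k (by simp)⟩, by
    rintro ⟨h1, h2, h3⟩ m (rfl | rfl | rfl) <;> assumption⟩

lemma mem_centralizer_singleton {h x : g} : x ∈ centralizer K {h} ↔ ⁅x, h⁆ = 0 :=
  ⟨fun hx ↦ hx h (by simp), by rintro h1 m rfl; exact h1⟩

lemma lie_eq_zero_comm {x y : g} : ⁅x, y⁆ = 0 ↔ ⁅y, x⁆ = 0 := by
  rw [← lie_skew, neg_eq_zero]

variable [IsAlgClosed K] [FiniteDimensional K g]

/-- Let `M` be a set whose centralizer has nondegenerate Killing form, and such that all semisimple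
elements of the centralizer are central in it. Then the centralizer consists of semisimple
elements. -/
lemma isSemisimpleElement_of_mem_centralizer [LieAlgebra.IsKilling K g] {M : Set g}
    (hM : ∀ x ∈ centralizer K M, (∀ y ∈ centralizer K M, killingForm K g x y = 0) → x = 0)
    (hcentral : ∀ s ∈ centralizer K M, IsSemisimpleElement K s →
      ∀ y ∈ centralizer K M, ⁅s, y⁆ = 0) {x : g} (hx : x ∈ centralizer K M) :
    IsSemisimpleElement K x := by
  have hjordan (x : g) (hx : x ∈ centralizer K M) : ∃ s ∈ centralizer K M,
      IsSemisimpleElement K s ∧ IsNilpotent (LieAlgebra.ad K g (x - s)) := by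
    obtain ⟨s, hs, hn, hcomm⟩ := exists_isSemisimple_ad_isNilpotent_ad_sub (K := K) x
    exact ⟨s, fun m hm ↦ hcomm m (hx m hm), hs, hn⟩
  -- Engel's theorem: `s` is central, so `x` acts on the centralizer as its nilpotent part `x - s`.
  have hnil : LieRing.IsNilpotent (centralizer K M) := by
    rw [LieAlgebra.isNilpotent_iff_forall (R := K)]
    rintro ⟨x, hx⟩
    obtain ⟨s, hs, hss, hn⟩ := hjordan x hx
    have h1 := LieSubalgebra.isNilpotent_ad_of_isNilpotent_ad (centralizer K M)
      (x := ⟨x - s, sub_mem hx hs⟩) hn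
    convert h1 using 1
    ext ⟨y, hy⟩
    simp [sub_lie, hcentral s hs hss y hy]
  have hab : IsLieAbelian (centralizer K M) := by
    refine LieModule.isLieAbelian_of_ker_traceForm_eq_bot K (centralizer K M) g ?_
    rw [LinearMap.ker_eq_bot']
    rintro ⟨x, hx⟩ h
    refine Subtype.ext (hM x hx fun y hy ↦ ?_)
    exact congrArg (fun φ ↦ φ ⟨y, hy⟩) h
  obtain ⟨s, hs, hss, hn⟩ := hjordan x hx
  have hxs : x - s = 0 := by
    refine hM _ (sub_mem hx hs) fun y hy ↦ killingForm_eq_zero_of_isNilpotent_ad hn ?_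
    exact congrArg Subtype.val
      (trivial_lie_zero _ _ (⟨x - s, sub_mem hx hs⟩ : centralizer K M) ⟨y, hy⟩)
  rw [sub_eq_zero.mp hxs]
  exact hss

end SemiPrincipal

/-! ### The main theorem. -/

open SemiPrincipal

theorem theorem5p2 {K : Type*} [Field K] [IsAlgClosed K] [CharZero K]
    {g : Type*} [LieRing g] [LieAlgebra K g] [FiniteDimensional K g] [LieAlgebra.IsSemisimple K g]
    (e₁ h₁ f₁ e₂ h₂ f₂ : g)
    (hspr : SemiPrincipal.IsSemiPrincipalRectangular K e₁ h₁ f₁ e₂ h₂ f₂)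
    (k₁ k₂ l₂ c₂ : LieSubalgebra K g)
    (hk₁ : k₁ = SemiPrincipal.centralizer K {e₁, h₁})
    (hk₂ : k₂ = SemiPrincipal.centralizer K {e₂, h₂})
    (hl₂ : l₂ = SemiPrincipal.centralizer K {h₂})
    (hc₂ : c₂ = SemiPrincipal.centre l₂) :
    SemiPrincipal.centralizer K {e₁, h₁, h₂} = c₂ ∧
    (SemiPrincipal.IsCartanSubalgebraOf k₁ c₂ ∧ SemiPrincipal.IsRegularNilpotentIn k₁ e₂) ∧
    SemiPrincipal.IsReductiveDualPair k₁ k₂ := by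
  obtain ⟨-, hnil₂, t₁, t₂, hcomm, ⟨he₁l, -, hdist⟩, ⟨⟨he₂k, hh₂k, hf₂k⟩, -, heven⟩⟩ := hspr
  have hh₁₂ : ⁅h₁, h₂⁆ = 0 := hcomm h₁ (by simp) h₂ (by simp)
  have he₁₂ : ⁅e₁, h₂⁆ = 0 := mem_centralizer_singleton.mp he₁l
  rw [← hl₂] at hdist
  rw [← hk₁] at he₂k hh₂k hf₂k heven
  have hmk₁ {x : g} : x ∈ k₁ ↔ ⁅x, e₁⁆ = 0 ∧ ⁅x, h₁⁆ = 0 := hk₁ ▸ mem_centralizer_pair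
  have hmk₂ {x : g} : x ∈ k₂ ↔ ⁅x, e₂⁆ = 0 ∧ ⁅x, h₂⁆ = 0 := hk₂ ▸ mem_centralizer_pair
  have hml₂ {x : g} : x ∈ l₂ ↔ ⁅x, h₂⁆ = 0 := hl₂ ▸ mem_centralizer_singleton
  have hmc₂ {x : g} : x ∈ c₂ ↔ x ∈ l₂ ∧ ∀ y ∈ l₂, ⁅x, y⁆ = 0 := hc₂ ▸ Iff.rfl
  -- the `sl₂`-triple in `k₁`
  let E : k₁ := ⟨e₂, he₂k⟩
  let H : k₁ := ⟨h₂, hh₂k⟩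
  let F : k₁ := ⟨f₂, hf₂k⟩
  have tk : IsTriple E H F :=
    ⟨Subtype.ext t₂.lie_h_e, Subtype.ext t₂.lie_h_f, Subtype.ext t₂.lie_e_f⟩
  have tk' := tk.isSl2Action (K := K)
  have hevenk (c : K) (hc : ∃ v : k₁, v ≠ 0 ∧ LieAlgebra.ad K k₁ H v = c • v) :
      ∃ n : ℤ, c = 2 * (n : K) := by
    obtain ⟨v, hv, hvc⟩ := hc
    exact heven c ⟨v, v.2, fun h ↦ hv (Subtype.ext h), congrArg Subtype.val hvc⟩
  -- nondegeneracy of the Killing form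
  have hκ₁ : ∀ x ∈ k₁, (∀ y ∈ k₁, killingForm K g x y = 0) → x = 0 := by
    subst hk₁
    exact fun x hx ↦ t₁.eq_zero_of_killingForm_eq_zero hx
  have hκ₂ : ∀ x ∈ k₂, (∀ y ∈ k₂, killingForm K g x y = 0) → x = 0 := by
    subst hk₂
    exact fun x hx ↦ t₂.eq_zero_of_killingForm_eq_zero hx
  have hmq {x : g} : x ∈ centralizer K {e₁, h₁, h₂} ↔ x ∈ k₁ ∧ x ∈ l₂ := by
    rw [mem_centralizer_triple, hmk₁, hml₂, and_assoc]
  have hκq : ∀ x ∈ centralizer K {e₁, h₁, h₂},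
      (∀ y ∈ centralizer K {e₁, h₁, h₂}, killingForm K g x y = 0) → x = 0 := by
    intro x hx hxq
    refine hκ₁ x (hmq.mp hx).1 fun y hy ↦ ?_
    have hy' : (⟨y, hy⟩ : k₁) ∈
        LinearMap.ker (LieAlgebra.ad K k₁ H) ⊔ LinearMap.range (LieAlgebra.ad K k₁ H) := by
      rw [ker_sup_range_eq_top tk'.iSup_eigenspace_eq_top]; exact Submodule.mem_top
    obtain ⟨v, hv, _, ⟨w, rfl⟩, hvw⟩ := Submodule.mem_sup.mp hy'
    have hvq : (v : g) ∈ centralizer K {e₁, h₁, h₂} :=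
      hmq.mpr ⟨v.2, hml₂.mpr (lie_eq_zero_comm.mp (congrArg Subtype.val hv))⟩
    rw [show y = v + ⁅h₂, (w : g)⁆ from (congrArg Subtype.val hvw).symm, map_add, hxq v hvq,
      ← LieModule.traceForm_apply_lie_apply, hml₂.mp (hmq.mp hx).2, map_zero,
      LinearMap.zero_apply, add_zero]
  -- the double centralizer in `l₂`
  have hcq : ∀ x ∈ c₂, x ∈ centralizer K {e₁, h₁, h₂} := fun x hx ↦
    mem_centralizer_triple.mpr ⟨(hmc₂.mp hx).2 e₁ (hml₂.mpr he₁₂),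
      (hmc₂.mp hx).2 h₁ (hml₂.mpr hh₁₂), hml₂.mp (hmc₂.mp hx).1⟩
  have hss : ∀ s ∈ centralizer K {e₁, h₁, h₂}, IsSemisimpleElement K s → s ∈ c₂ :=
    fun s hs hs' ↦ hc₂ ▸ hdist s (hmq.mp hs).2 (mem_centralizer_triple.mp hs).1 hs'
  have hq : centralizer K {e₁, h₁, h₂} = c₂ := by
    refine le_antisymm (fun x hx ↦ hss x hx ?_) hcq
    exact isSemisimpleElement_of_mem_centralizer hκq
      (fun s hs hs' y hy ↦ (hmc₂.mp (hss s hs hs')).2 y (hmq.mp hy).2) hx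
  have hmc₂' {x : g} : x ∈ c₂ ↔ x ∈ k₁ ∧ ⁅x, h₂⁆ = 0 := by rw [← hq, hmq, hml₂]
  have hcc {x y : g} (hx : x ∈ c₂) (hy : y ∈ c₂) : ⁅x, y⁆ = 0 :=
    (hmc₂.mp hx).2 y (hmc₂.mp hy).1
  have hh₂c : h₂ ∈ c₂ := hmc₂'.mpr ⟨hh₂k, lie_self h₂⟩
  have hker {v : k₁} : v ∈ LinearMap.ker (LieAlgebra.ad K k₁ H) ↔ (v : g) ∈ c₂ := by
    rw [hmc₂', and_iff_right v.2, lie_eq_zero_comm]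
    exact ⟨fun h ↦ congrArg Subtype.val h, fun h ↦ Subtype.ext h⟩
  -- the Cartan subalgebra
  have hcartan : IsCartanSubalgebraOf k₁ c₂ := by
    refine ⟨fun x hx ↦ (hmc₂'.mp hx).1, ⟨?_, ?_⟩⟩
    · have : IsLieAbelian (c₂.comap k₁.incl) :=
        ⟨fun x y ↦ Subtype.ext (Subtype.ext (hcc x.2 y.2))⟩
      infer_instance
    · refine le_antisymm (fun x hx ↦ ?_) (LieSubalgebra.le_normalizer _)
      have h1 : ⁅(x : g), h₂⁆ ∈ c₂ := (LieSubalgebra.mem_normalizer_iff _ x).mp hx H hh₂c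
      have h2 : x ∈ (LieAlgebra.ad K k₁ H).maxGenEigenspace 0 := by
        rw [mem_maxGenEigenspace]
        -- If `x` normalizes `c₂`, then `⁅h₂, x⁆` lies in the abelian `c₂`, so `(ad h₂)² x = 0`;
        -- diagonalizability of `ad h₂` then gives `⁅h₂, x⁆ = 0`.
        refine ⟨2, Subtype.ext ?_⟩
        have : ⁅h₂, ⁅h₂, (x : g)⁆⁆ = 0 :=
          hcc hh₂c (by rw [← lie_skew]; exact neg_mem h1)
        simpa [pow_two] using this
      rw [tk'.maxGenEigenspace_eq, eigenspace_zero, hker] at h2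
      exact h2
  have hrank : finrank K (LinearMap.ker (LieAlgebra.ad K k₁ E)) = LieAlgebra.rank K k₁ := by
    rw [tk'.finrank_ker_E hevenk]
    refine le_antisymm (finrank_ker_ad_le_rank tk'.iSup_eigenspace_eq_top fun x y hx hy ↦ ?_) ?_
    · exact Subtype.ext (hcc (hker.mp hx) (hker.mp hy))
    · refine (LieAlgebra.rank_le_finrank_engel K H).trans_eq ?_
      change finrank K ((LieAlgebra.ad K k₁ H).maxGenEigenspace 0) = _
      rw [tk'.maxGenEigenspace_eq, eigenspace_zero]
  have hregular : IsRegularNilpotentIn k₁ e₂ := by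
    refine ⟨he₂k, hnil₂, ?_⟩
    have hmap : (k₁ ⊓ centralizer K {e₂}).toSubmodule =
        (LinearMap.ker (LieAlgebra.ad K k₁ E)).map k₁.toSubmodule.subtype := by
      ext x
      constructor
      · rintro ⟨hx, hx'⟩
        exact ⟨⟨x, hx⟩, Subtype.ext (lie_eq_zero_comm.mp (mem_centralizer_singleton.mp hx')), rfl⟩
      · rintro ⟨v, hv, rfl⟩
        exact ⟨v.2, mem_centralizer_singleton.mpr (lie_eq_zero_comm.mp (congrArg Subtype.val hv))⟩
    change finrank K (k₁ ⊓ centralizer K {e₂}).toSubmodule = _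
    rw [← hrank, hmap]
    exact Submodule.finrank_map_subtype_eq _ _
  -- the dual pair
  have hcommute : ∀ x ∈ k₂, ∀ y ∈ k₁, ⁅x, y⁆ = 0 := by
    intro x hx
    obtain ⟨hxe, hxh⟩ := hmk₂.mp hx
    have hxf := t₂.lie_f_eq_zero K hxe hxh
    -- The centralizer of `x` in `k₁` is stable under `ad e₂` and `ad f₂` and contains the zero
    -- weight space `c₂`.
    let C : Submodule K k₁ := LinearMap.ker (LieAlgebra.ad K g x ∘ₗ k₁.toSubmodule.subtype)
    have hC {v : k₁} : v ∈ C ↔ ⁅x, (v : g)⁆ = 0 := Iff.rfl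
    have hCtop : C = ⊤ := by
      refine tk'.eq_top_of_ker_le hevenk (fun v hv ↦ ?_) (fun v hv ↦ ?_) fun v hv ↦ ?_
      · change ⁅x, ⁅e₂, (v : g)⁆⁆ = 0
        rw [leibniz_lie, hxe, hC.mp hv, zero_lie, lie_zero, add_zero]
      · change ⁅x, ⁅f₂, (v : g)⁆⁆ = 0
        rw [leibniz_lie, hxf, hC.mp hv, zero_lie, lie_zero, add_zero]
      · exact lie_eq_zero_comm.mp ((hmc₂.mp (hker.mp hv)).2 x (hml₂.mpr hxh))
    exact fun y hy ↦ hC.mp (hCtop ▸ Submodule.mem_top : (⟨y, hy⟩ : k₁) ∈ C)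
  have he₁k₂ : e₁ ∈ k₂ := hmk₂.mpr ⟨hcomm e₁ (by simp) e₂ (by simp), he₁₂⟩
  have hh₁k₂ : h₁ ∈ k₂ := hmk₂.mpr ⟨hcomm h₁ (by simp) e₂ (by simp), hh₁₂⟩
  have hdual : IsDualPair k₁ k₂ := by
    constructor
    · exact le_antisymm (fun x hx y hy ↦ hcommute x hx y hy)
        fun x hx ↦ hmk₂.mpr ⟨hx e₂ he₂k, hx h₂ hh₂k⟩
    · exact le_antisymm (fun x hx y hy ↦ lie_eq_zero_comm.mp (hcommute y hy x hx))
        fun x hx ↦ hmk₁.mpr ⟨hx e₁ he₁k₂, hx h₁ hh₁k₂⟩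
  refine ⟨hq, ⟨hcartan, hregular⟩, hdual, ?_, ?_⟩
  · subst hk₁
    exact isReductiveSubalgebra_centralizer hκ₁
  · subst hk₂
    exact isReductiveSubalgebra_centralizer hκ₂
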